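/- Let $\Bbbk$ be a field and let $\mathcal P=(\mathcal P(n))_{n\ge 0}$ be a symmetric operad over $\Bbbk$-vector spaces, with identity $1\in\mathcal P(1)$ and partial compositions $\circ_i:\mathcal P(m)\otimes\mathcal P(n)\to\mathcal P(m+n-1)$. Suppose that $\mathcal P$ is 2-unitary: $\mathcal P(0)=\Bbbk 1_0\cong\Bbbk$ is one-dimensional with basis $1_0$, and there is $1_2\in\mathcal P(2)$ with $1_2\circ_1 1_0=1=1_2\circ_2 1_0$. Suppose also that $\mathcal P$ has Gelfand–Kirillov dimension two, where $$\mathrm{GKdim}\,\mathcal P=\limsup_{n\to\infty}\ \log_n\Big(\sum_{i=0}^n\dim_\Bbbk\mathcal P(i)\Big).$$ Let $\bar A\subset\mathcal P(1)$ be the augmentation ideal of the associative algebra $(\mathcal P(1),\circ_1)$, that is, the kernel of the algebra map $\varepsilon:\mathcal P(1)\to\Bbbk$ given by $\theta\circ_1 1_0=\varepsilon(\theta)1_0$; it is a non-unital associative algebra. Let $\mathrm{Der}(\mathcal P)$ be the Lie algebra of families of $\Bbbk$-linear, $S_n$-equivariant maps $\partial:\mathcal P(n)\to\mathcal P(n)$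 such that $\partial(\mu\circ_i\nu)=\partial(\mu)\circ_i\nu+\mu\circ_i\partial(\nu)$ always. Let $\mathrm{IDer}(\mathcal P)$ be the Lie ideal of inner derivations $\theta\mapsto\lambda\circ_1\theta-\sum_{i=1}^n\theta\circ_i\lambda$ ($\theta\in\mathcal P(n)$), for $\lambda\in\mathcal P(1)$, and let $H^1(\mathcal P)=\mathrm{Der}(\mathcal P)/\mathrm{IDer}(\mathcal P)$. Let $\mathrm{Der}(\bar A)$ be the Lie algebra of $\Bbbk$-linear derivations of $\bar A$, let $\mathrm{IDer}(\bar A)$ be the Lie ideal of the derivations $x\mapsto ax-xa$ with $a\in\bar A$, and let $HH^1(\bar A)=\mathrm{Der}(\bar A)/\mathrm{IDer}(\bar A)$. Then there is a short exact sequence of Lie algebras $$0\to\Bbbk\xrightarrow{\ \iota\ }\mathrm{Der}(\mathcal P)\xrightarrow{\ \pi\ }\mathrm{Der}(\bar A)\to 0,$$ in which $\Bbbk$ is abelian, $\iota(c)$ is multiplication by $(n-1)c$ on $\mathcal P(n)$, and $\pi$ is restriction to $\bar A$. Consequently there is an isomorphism of Lie algebras $\mathrm{Der}(\mathcal P)\cong\Bbbk\rtimes\mathrm{Der}(\bar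 A)$, for some action of $\mathrm{Der}(\bar A)$ on $\Bbbk$, compatible with this sequence; and $\pi$ induces an isomorphism of Lie algebras $H^1(\mathcal P)\cong HH^1(\bar A)$. -/

import Mathlib

universe u v

/-! An associative algebra is a Lie algebra under the commutator bracket. -/

attribute [local instance] LieRing.ofAssociativeRing

/-! ## Block permutations

All positions are counted from `0`.  If an operation with `n` inputs is plugged into the input `i`
of an operation with `m` inputs, the result has `r` inputs, where `m + n = r + 1`.  Its inputs are
the inputs `a ≠ i` of the outer operation and the `n` inputs of the inner one. -/

/-- The position, among the `r` inputs of a partial composite at `i`, of an input of the outer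
operation different from `i`, or of an input of the inner operation. -/
def insertPos {m n r : ℕ} (i : Fin m) (h : m + n = r + 1) :
    {a : Fin m // a ≠ i} ⊕ Fin n → Fin r
  | Sum.inl a => ⟨if (a.1 : ℕ) < i then (a.1 : ℕ) else a.1 + n - 1, by
      have h1 := a.1.2
      have h2 := i.2
      have h3 : (a.1 : ℕ) ≠ i := fun e => a.2 (Fin.ext e)
      split_ifs <;> omega⟩
  | Sum.inr k => ⟨i + k, by
      have h1 := k.2
      have h2 := i.2
      omega⟩

theorem insertPos_bijective {m n r : ℕ} (i : Fin m) (h : m + n = r + 1) :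
    Function.Bijective (insertPos i h) := by
  rw [Fintype.bijective_iff_injective_and_card]
  constructor
  · rintro (⟨a, ha⟩ | a) (⟨b, hb⟩ | b) hab
    · have h3 : (a : ℕ) ≠ i := fun e => ha (Fin.ext e)
      have h4 : (b : ℕ) ≠ i := fun e => hb (Fin.ext e)
      simp only [insertPos, Fin.mk.injEq] at hab
      congr 2
      apply Fin.ext
      split_ifs at hab <;> omega
    · have h3 : (a : ℕ) ≠ i := fun e => ha (Fin.ext e)
      have h4 := b.2
      simp only [insertPos, Fin.mk.injEq] at hab
      split_ifs at hab <;> omega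
    · have h3 : (b : ℕ) ≠ i := fun e => hb (Fin.ext e)
      have h4 := a.2
      simp only [insertPos, Fin.mk.injEq] at hab
      split_ifs at hab <;> omega
    · simp only [insertPos, Fin.mk.injEq] at hab
      congr 1
      apply Fin.ext
      omega
  · have h2 := i.2
    simp only [ne_eq, Fintype.card_sum, Fintype.card_subtype_compl, Fintype.card_fin,
      Fintype.card_unique]
    omega

/-- The inputs of a partial composite at `i`, as a disjoint union. -/
noncomputable def insertEquiv {m n r : ℕ} (i : Fin m) (h : m + n = r + 1) :
    {a : Fin m // a ≠ i} ⊕ Fin n ≃ Fin r :=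
  Equiv.ofBijective (insertPos i h) (insertPos_bijective i h)

/-- The permutation `1_m ∘ᵢ σ`: it permutes the block inserted at `i` by `σ` and fixes everything
else. -/
noncomputable def innerPerm {m n r : ℕ} (i : Fin m) (h : m + n = r + 1)
    (σ : Equiv.Perm (Fin n)) : Equiv.Perm (Fin r) :=
  ((insertEquiv i h).symm.trans (Equiv.sumCongr (Equiv.refl _) σ)).trans (insertEquiv i h)

/-- The permutation `φ ∘ᵢ 1_n`: it moves the block inserted at `i`, unpermuted, to the block
inserted at `φ i`, and moves the other inputs as `φ` does. -/
noncomputable def outerPerm {m n r : ℕ} (i : Fin m) (h : m + n = r + 1)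
    (φ : Equiv.Perm (Fin m)) : Equiv.Perm (Fin r) :=
  ((insertEquiv i h).symm.trans
    (Equiv.sumCongr (φ.subtypeEquiv (fun _ => not_congr φ.injective.eq_iff.symm))
      (Equiv.refl (Fin n)))).trans (insertEquiv (φ i) h)

/-! ## Operads -/

/-- A symmetric operad over `k`, in its partial definition.  The partial composition
`comp i h μ ν` is `μ ∘ᵢ ν`, with `0 ≤ i < m` counted from `0`; its arity `m + n - 1` is written as
any `r` with `m + n = r + 1`. -/
structure SymmOperad (k : Type u) [Field k] where
  /-- the space of operations with `n` inputs -/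
  obj : ℕ → Type v
  [addCommGroup : ∀ n, AddCommGroup (obj n)]
  [module : ∀ n, Module k (obj n)]
  /-- the right action of the symmetric group: `act σ θ` is `θ ∗ σ` -/
  act : ∀ {n : ℕ}, Equiv.Perm (Fin n) → obj n →ₗ[k] obj n
  act_one : ∀ {n : ℕ} (θ : obj n), act 1 θ = θ
  act_mul : ∀ {n : ℕ} (σ τ : Equiv.Perm (Fin n)) (θ : obj n), act (σ * τ) θ = act τ (act σ θ)
  /-- the identity operation -/
  one : obj 1
  /-- the partial compositions -/
  comp : ∀ {m n r : ℕ} (_ : Fin m) (_ : m + n = r + 1), obj m →ₗ[k] obj n →ₗ[k] obj r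
  comp_one : ∀ {n : ℕ} (i : Fin n) (θ : obj n), comp i rfl θ one = θ
  one_comp : ∀ {n : ℕ} (θ : obj n), comp 0 (Nat.add_comm 1 n) one θ = θ
  /-- `(lam ∘ᵢ μ) ∘ₚ ν = lam ∘ᵢ (μ ∘ⱼ ν)` for `p = i + j` (positions counted from `0`) -/
  comp_assoc : ∀ {l m n r s t : ℕ} (i : Fin l) (j : Fin m) (p : Fin r)
    (hr : l + m = r + 1) (hs : r + n = s + 1) (ht : m + n = t + 1) (hs' : l + t = s + 1)
    (_ : (p : ℕ) = i + j) (lam : obj l) (μ : obj m) (ν : obj n),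
    comp p hs (comp i hr lam μ) ν = comp i hs' lam (comp j ht μ ν)
  /-- `(lam ∘ᵢ μ) ∘ₚ ν = (lam ∘ⱼ ν) ∘_q μ` for `i < j`, `p = j - 1 + m` and `q = i`
  (positions counted from `0`) -/
  comp_comm : ∀ {l m n r s t : ℕ} (i j : Fin l) (p : Fin r) (q : Fin t)
    (hr : l + m = r + 1) (hs : r + n = s + 1) (ht : l + n = t + 1) (hs' : t + m = s + 1)
    (_ : i < j) (_ : (p : ℕ) + 1 = j + m) (_ : (q : ℕ) = i)
    (lam : obj l) (μ : obj m) (ν : obj n),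
    comp p hs (comp i hr lam μ) ν = comp q hs' (comp j ht lam ν) μ
  comp_act : ∀ {m n r : ℕ} (i : Fin m) (h : m + n = r + 1) (σ : Equiv.Perm (Fin n))
    (μ : obj m) (ν : obj n), comp i h μ (act σ ν) = act (innerPerm i h σ) (comp i h μ ν)
  act_comp : ∀ {m n r : ℕ} (i : Fin m) (h : m + n = r + 1) (φ : Equiv.Perm (Fin m))
    (μ : obj m) (ν : obj n), comp i h (act φ μ) ν = act (outerPerm i h φ) (comp (φ i) h μ ν)

attribute [instance] SymmOperad.addCommGroup SymmOperad.module

/-! ## Derivations of a possibly non-unital associative algebra -/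

section NonUnitalAlgebra

/-- The Lie algebra `Der(A)` of derivations of an associative algebra, unital or not. -/
def AlgDer (k A : Type*) [CommRing k] [NonUnitalRing A] [Module k A] [IsScalarTower k A A]
    [SMulCommClass k A A] : LieSubalgebra k (Module.End k A) where
  carrier := {D | ∀ a b : A, D (a * b) = D a * b + a * D b}
  add_mem' := by
    intro D E hD hE a b
    simp only [Set.mem_ofPred_eq] at hD hE
    simp only [LinearMap.add_apply, hD, hE, add_mul, mul_add]
    abel
  zero_mem' := by
    intro a b
    simp
  smul_mem' := by
    intro c D hD a b
    simp only [Set.mem_ofPred_eq] at hD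
    simp only [LinearMap.smul_apply, hD, smul_add, smul_mul_assoc, mul_smul_comm]
  lie_mem' := by
    intro D E hD hE a b
    simp only [LinearMap.sub_apply, Ring.lie_def, Module.End.mul_apply]
    rw [hE a b, hD a b, map_add, map_add, hD, hD, hE, hE, sub_mul, mul_sub]
    abel

/-- The Lie ideal `IDer(A)` of `Der(A)`: the inner derivations `x ↦ a x - x a` with `a ∈ A`. -/
def AlgInnerDer (k A : Type*) [CommRing k] [NonUnitalRing A] [Module k A] [IsScalarTower k A A]
    [SMulCommClass k A A] : LieIdeal k (AlgDer k A) where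
  carrier := {D | ∃ a : A, ∀ x : A, D.1 x = a * x - x * a}
  add_mem' := by
    rintro D E ⟨a, ha⟩ ⟨b, hb⟩
    refine ⟨a + b, fun x => ?_⟩
    have h : (D + E).1 x = D.1 x + E.1 x := rfl
    rw [h, ha, hb, add_mul, mul_add]
    abel
  zero_mem' := ⟨0, fun x => by
    rw [zero_mul, mul_zero, sub_zero]
    rfl⟩
  smul_mem' := by
    rintro c D ⟨a, ha⟩
    refine ⟨c • a, fun x => ?_⟩
    have h : (c • D).1 x = c • D.1 x := rfl
    rw [h, ha, smul_sub, smul_mul_assoc, mul_smul_comm]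
  lie_mem := by
    rintro D E ⟨a, ha⟩
    refine ⟨D.1 a, fun x => ?_⟩
    have h : (⁅D, E⁆ : AlgDer k A).1 x = D.1 (E.1 x) - E.1 (D.1 x) := rfl
    rw [h, ha, ha, map_sub, D.2 a x, D.2 x a]
    abel

/-- The first Hochschild cohomology `HH¹(A) = Der(A)/IDer(A)`, with its Lie algebra structure. -/
abbrev HH1 (k A : Type*) [CommRing k] [NonUnitalRing A] [Module k A] [IsScalarTower k A A]
    [SMulCommClass k A A] : Type _ :=
  AlgDer k A ⧸ AlgInnerDer k A

end NonUnitalAlgebra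

namespace SymmOperad



variable {k : Type u} [Field k] (O : SymmOperad.{u, v} k)

/-! ## Derivations of an operad -/

/-- The Lie algebra `Der(O)` of derivations of an operad: the degree-preserving, linear and
equivariant maps satisfying the Leibniz rule for all partial compositions, with the commutator
bracket. -/
def Der : LieSubalgebra k (∀ n, Module.End k (O.obj n)) where
  carrier := {D | (∀ (n : ℕ) (σ : Equiv.Perm (Fin n)) (θ : O.obj n),
      D n (O.act σ θ) = O.act σ (D n θ)) ∧
    ∀ (m n r : ℕ) (i : Fin m) (h : m + n = r + 1) (μ : O.obj m) (ν : O.obj n),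
      D r (O.comp i h μ ν) = O.comp i h (D m μ) ν + O.comp i h μ (D n ν)}
  add_mem' := by
    rintro D E ⟨hD, hD'⟩ ⟨hE, hE'⟩
    refine ⟨fun n σ θ => ?_, fun m n r i h μ ν => ?_⟩
    · simp [hD, hE]
    · simp only [Pi.add_apply, LinearMap.add_apply, hD', hE', map_add]
      abel
  zero_mem' := by
    refine ⟨fun n σ θ => ?_, fun m n r i h μ ν => ?_⟩ <;> simp
  smul_mem' := by
    rintro c D ⟨hD, hD'⟩
    refine ⟨fun n σ θ => ?_, fun m n r i h μ ν => ?_⟩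
    · simp [hD]
    · simp [hD']
  lie_mem' := by
    rintro D E ⟨hD, hD'⟩ ⟨hE, hE'⟩
    have key : ∀ n (θ : O.obj n), (⁅D, E⁆ : ∀ n, Module.End k (O.obj n)) n θ
        = D n (E n θ) - E n (D n θ) := fun n θ => rfl
    refine ⟨fun n σ θ => ?_, fun m n r i h μ ν => ?_⟩
    · rw [key, key, hE, hD, hD, hE, map_sub]
    · rw [key, key, key, hE', hD', map_add, map_add, hD', hD', hE', hE', map_sub, map_sub,
        LinearMap.sub_apply]
      abel

/-- The Lie ideal `IDer(O)` of `Der(O)`: the inner derivations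
`θ ↦ lam ∘₁ θ - ∑ᵢ θ ∘ᵢ lam` with `lam ∈ O(1)`. -/
def InnerDer : LieIdeal k O.Der where
  carrier := {D | ∃ lam : O.obj 1, ∀ (n : ℕ) (θ : O.obj n),
    D.1 n θ = O.comp 0 (Nat.add_comm 1 n) lam θ - ∑ i : Fin n, O.comp i rfl θ lam}
  add_mem' := by
    rintro D E ⟨a, ha⟩ ⟨b, hb⟩
    refine ⟨a + b, fun n θ => ?_⟩
    have h : (D + E).1 n θ = D.1 n θ + E.1 n θ := rfl
    simp only [h, ha, hb, map_add, LinearMap.add_apply, Finset.sum_add_distrib]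
    abel
  zero_mem' := ⟨0, fun n θ => by
    simp only [map_zero, LinearMap.zero_apply, Finset.sum_const_zero, sub_zero]
    rfl⟩
  smul_mem' := by
    rintro c D ⟨a, ha⟩
    refine ⟨c • a, fun n θ => ?_⟩
    have h : (c • D).1 n θ = c • D.1 n θ := rfl
    simp only [h, ha, map_smul, LinearMap.smul_apply, smul_sub, Finset.smul_sum]
  lie_mem := by
    rintro D E ⟨a, ha⟩
    refine ⟨D.1 1 a, fun n θ => ?_⟩
    have h : (⁅D, E⁆ : O.Der).1 n θ = D.1 n (E.1 n θ) - E.1 n (D.1 n θ) := rfl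
    rw [h, ha, ha, map_sub, map_sum, D.2.2 1 n n]
    simp only [D.2.2 n 1 n, Finset.sum_add_distrib]
    abel

/-- The first cohomology group `H¹(O) = Der(O)/IDer(O)`, with its Lie algebra structure. -/
abbrev H1 : Type _ := O.Der ⧸ O.InnerDer

/-! ## The algebra `O(1)` and its augmentation ideal -/

/-- The associative algebra `O(1)`, with product `∘₁` and unit the identity operation. -/
def Unary : Type v := O.obj 1

instance : AddCommGroup O.Unary := inferInstanceAs (AddCommGroup (O.obj 1))

instance : Module k O.Unary := inferInstanceAs (Module k (O.obj 1))

instance : Ring O.Unary :=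
  { (inferInstance : AddCommGroup O.Unary) with
    mul := fun a b => O.comp (m := 1) (n := 1) (r := 1) 0 rfl a b
    one := O.one
    zero_mul := fun a => LinearMap.map_zero₂ (O.comp (m := 1) (n := 1) (r := 1) 0 rfl) a
    mul_zero := fun a => (O.comp (m := 1) (n := 1) (r := 1) 0 rfl a).map_zero
    left_distrib := fun a b c => (O.comp (m := 1) (n := 1) (r := 1) 0 rfl a).map_add b c
    right_distrib := fun a b c =>
      LinearMap.map_add₂ (O.comp (m := 1) (n := 1) (r := 1) 0 rfl) a b c
    mul_assoc := fun a b c => O.comp_assoc 0 0 0 rfl rfl rfl rfl rfl a b c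
    one_mul := fun a => O.one_comp (n := 1) a
    mul_one := fun a => O.comp_one (n := 1) 0 a }

instance : Algebra k O.Unary :=
  Algebra.ofModule
    (fun c a b => LinearMap.map_smul₂ (O.comp (m := 1) (n := 1) (r := 1) 0 rfl) c a b)
    (fun c a b => (O.comp (m := 1) (n := 1) (r := 1) 0 rfl a).map_smul c b)

/-- `e` is a `0`-unit of `O`: it is a basis of `O(0)`, so that `O(0) = k e ≅ k`. -/
def IsZeroUnit (e : O.obj 0) : Prop := Function.Bijective fun c : k => c • e

/-- `w ∈ O(2)` is a `2`-unit with respect to the `0`-unit `e`: `w ∘₁ e = 1 = w ∘₂ e`. -/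
def IsTwoUnit (e : O.obj 0) (w : O.obj 2) : Prop :=
  O.comp (m := 2) (n := 0) (r := 1) 0 rfl w e = O.one ∧ O.comp (m := 2) (n := 0) (r := 1) 1 rfl w e = O.one

variable {O}

/-- The isomorphism `k ≅ O(0)` given by a `0`-unit. -/
noncomputable def IsZeroUnit.equiv {e : O.obj 0} (he : O.IsZeroUnit e) : k ≃ₗ[k] O.obj 0 :=
  LinearEquiv.ofBijective (LinearMap.toSpanSingleton k (O.obj 0) e) he

theorem IsZeroUnit.equiv_symm_smul {e : O.obj 0} (he : O.IsZeroUnit e) (x : O.obj 0) :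
    he.equiv.symm x • e = x :=
  he.equiv.apply_symm_apply x

theorem IsZeroUnit.smul_injective {e : O.obj 0} (he : O.IsZeroUnit e) {c d : k}
    (h : c • e = d • e) : c = d :=
  he.1 h

/-- The augmentation `ε : O(1) → k` of the algebra `O(1)` of a unitary operad, that is, composition
with the `0`-unit: `θ ∘₁ e = ε(θ) e`. -/
noncomputable def IsZeroUnit.augmentation {e : O.obj 0} (he : O.IsZeroUnit e) : O.Unary →ₐ[k] k :=
  AlgHom.ofLinearMap
    (he.equiv.symm.toLinearMap ∘ₗ
      (O.comp (m := 1) (n := 0) (r := 0) 0 rfl).flip e : O.obj 1 →ₗ[k] k)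
    (by
      apply he.smul_injective
      rw [one_smul]
      exact (he.equiv_symm_smul _).trans (O.one_comp e))
    (by
      intro a b
      apply he.smul_injective
      refine (he.equiv_symm_smul _).trans ?_
      refine (O.comp_assoc (l := 1) (m := 1) (n := 0) 0 0 0 rfl rfl rfl rfl rfl a b e).trans ?_
      have hb : O.comp (m := 1) (n := 0) (r := 0) 0 rfl b e
          = he.equiv.symm (O.comp (m := 1) (n := 0) (r := 0) 0 rfl b e) • e :=
        (he.equiv_symm_smul _).symm
      have ha : O.comp (m := 1) (n := 0) (r := 0) 0 rfl a e
          = he.equiv.symm (O.comp (m := 1) (n := 0) (r := 0) 0 rfl a e) • e :=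
        (he.equiv_symm_smul _).symm
      rw [hb, map_smul, ha, smul_smul, mul_comm]
      rfl)

/-- The augmentation ideal of the algebra `O(1)` of a unitary operad, as a non-unital algebra. -/
def IsZeroUnit.augIdeal {e : O.obj 0} (he : O.IsZeroUnit e) : NonUnitalSubalgebra k O.Unary where
  carrier := {θ | he.augmentation θ = 0}
  add_mem' := by
    intro a b ha hb
    simp only [Set.mem_ofPred_eq] at ha hb ⊢
    rw [map_add, ha, hb, add_zero]
  zero_mem' := map_zero _
  mul_mem' := by
    intro a b ha hb
    simp only [Set.mem_ofPred_eq] at ha hb ⊢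
    rw [map_mul, ha, zero_mul]
  smul_mem' := by
    intro c a ha
    simp only [Set.mem_ofPred_eq] at ha ⊢
    rw [map_smul, ha, smul_zero]

variable (O)

/-! ## Gelfand-Kirillov dimension -/

/-- `dim O(0) + ⋯ + dim O(n)`, which is `∞` if one of these spaces is infinite-dimensional. -/
noncomputable def growth (n : ℕ) : ENNReal :=
  ∑ i ∈ Finset.range (n + 1), ((Cardinal.toENat (Module.rank k (O.obj i)) : ℕ∞) : ENNReal)

/-- The Gelfand-Kirillov dimension `limsup_n log_n (dim O(0) + ⋯ + dim O(n))`. -/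
noncomputable def GKdim : EReal :=
  Filter.limsup (fun n : ℕ => ENNReal.log (O.growth n) / ENNReal.log (n : ENNReal)) Filter.atTop

end SymmOperad

/-! Write `A` for the algebra of unary operations and `ε` for the augmentation. Plugging `e` into
every input of `θ` except the `j`-th gives a unary operation `res e j θ`. The growth condition
forces these restrictions to determine `θ` in positive arity (`IsTwoUnit.ext_res`). Indeed, suppose
a nonzero operation of arity `m + 1 ≥ 2` dies under every face. The 2-unit splits the faces, so
ranks of joint kernels of faces satisfy Pascal's recursion, and `dim O(n) ≥ n.choose (m + 1)`. The
summed growth then has degree at least 3, contradicting dimension two.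

Restrictions of a composite `μ ∘ᵢ ν` are explicit: at an input of `ν` they are products in `A`, at
another input `a` of `μ` they are `ε(ν) res e a μ`. If `D e = -c e`, the Leibniz rule gives `res (D
θ) = D (res θ) + (n - 1) c res θ`, so `D` is determined by its weight `c` and its restriction to the
augmentation ideal. Conversely, a derivation `d` of the ideal, extended by `d 1 = 0`, lifts to `θ ↦
∑ᵢ uₙ ∘ᵢ d (res e i θ)`, where every restriction of `uₙ` is the identity. The weight vanishes on
brackets, so it splits the sequence as a direct product.

The inner derivation of the identity operation is multiplication by `1 - n`. The scaling derivations
are therefore inner, and disappear in `H1`. -/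

namespace SymmOperad

variable {k : Type u} [Field k] {O : SymmOperad.{u, v} k}

/-! ## Faces and restrictions -/

/-- Plugging a nullary operation into the input `i`. -/
def face (e : O.obj 0) {n : ℕ} (i : Fin (n + 1)) : O.obj (n + 1) →ₗ[k] O.obj n :=
  (O.comp (r := n) i rfl).flip e

theorem face_apply (e : O.obj 0) {n : ℕ} (i : Fin (n + 1)) (θ : O.obj (n + 1)) :
    face e i θ = O.comp (r := n) i rfl θ e := rfl

theorem face_comp_inner (e : O.obj 0) {m n r : ℕ} (i : Fin m) (h : m + (n + 1) = r + 1 + 1)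
    (j : Fin (n + 1)) (p : Fin (r + 1)) (hp : (p : ℕ) = i + j) (μ : O.obj m)
    (ν : O.obj (n + 1)) :
    face e p (O.comp i h μ ν) = O.comp i (by omega) μ (face e j ν) :=
  O.comp_assoc (n := 0) (s := r) (t := n) i j p h rfl rfl (by omega) hp μ ν e

theorem face_comp_outer_right (e : O.obj 0) {m n r : ℕ} (i : Fin (m + 1)) (i' : Fin m)
    (h : m + 1 + n = r + 1 + 1) (j : Fin (m + 1)) (p : Fin (r + 1)) (hij : i < j)
    (hi : (i' : ℕ) = i) (hp : (p : ℕ) + 1 = j + n) (μ : O.obj (m + 1)) (ν : O.obj n) :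
    face e p (O.comp i h μ ν) = O.comp i' (by omega) (face e j μ) ν :=
  O.comp_comm (n := 0) (s := r) (t := m) i j p i' h rfl rfl (by omega) hij hp hi μ ν e

theorem face_comp_outer_left (e : O.obj 0) {m n r : ℕ} (i : Fin (m + 1)) (i' : Fin m)
    (h : m + 1 + n = r + 1 + 1) (j : Fin (m + 1)) (p : Fin (r + 1)) (hij : j < i)
    (hi : (i' : ℕ) + 1 = i) (hp : (p : ℕ) = j) (μ : O.obj (m + 1)) (ν : O.obj n) :
    face e p (O.comp i h μ ν) = O.comp i' (by omega) (face e j μ) ν :=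
  (O.comp_comm (m := 0) (r := m) (s := r) j i i' p rfl (by omega) h rfl hij (by omega) hp μ e ν).symm

theorem face_face (e : O.obj 0) {n : ℕ} (i : Fin (n + 2)) (j : Fin (n + 2)) (i' j' : Fin (n + 1))
    (hij : i < j) (hi : (i' : ℕ) = i) (hj : (j' : ℕ) + 1 = j) (θ : O.obj (n + 2)) :
    face e j' (face e i θ) = face e i' (face e j θ) :=
  face_comp_outer_right (n := 0) (r := n) e i i' rfl j j' hij hi hj θ e

theorem face_act (e : O.obj 0) {n : ℕ} (i : Fin (n + 1)) (φ : Equiv.Perm (Fin (n + 1)))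
    (θ : O.obj (n + 1)) :
    face e i (O.act φ θ) = O.act (outerPerm (n := 0) (r := n) i rfl φ) (face e (φ i) θ) :=
  O.act_comp (n := 0) (r := n) i rfl φ θ e

theorem act_injective {n : ℕ} (φ : Equiv.Perm (Fin n)) :
    Function.Injective (O.act φ) := by
  intro x y h
  have h' := congrArg (O.act φ⁻¹) h
  rwa [← O.act_mul, ← O.act_mul, mul_inv_cancel, O.act_one, O.act_one] at h'

/-- The unary operation obtained by plugging `e` into all inputs except `j`. -/
def res (e : O.obj 0) : ∀ {n : ℕ}, Fin n → O.obj n →ₗ[k] O.obj 1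
  | 0, j => j.elim0
  | 1, _ => LinearMap.id
  | n + 2, j =>
    if h : j = Fin.last (n + 1) then res e (Fin.last n) ∘ₗ face e 0
    else res e (j.castPred h) ∘ₗ face e (Fin.last (n + 1))

theorem res_one (e : O.obj 0) (j : Fin 1) (θ : O.obj 1) : res e j θ = θ := rfl

theorem res_last (e : O.obj 0) {n : ℕ} (θ : O.obj (n + 2)) :
    res e (Fin.last (n + 1)) θ = res e (Fin.last n) (face e 0 θ) := by
  rw [res, dif_pos rfl]; rfl

theorem res_castSucc (e : O.obj 0) {n : ℕ} (j : Fin (n + 1)) (θ : O.obj (n + 2)) :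
    res e j.castSucc θ = res e j (face e (Fin.last (n + 1)) θ) := by
  rw [res, dif_neg (Fin.castSucc_ne_last j)]; rfl

/-- The recursion for `res` fixes an order of plugging; by the commutation of faces the order is
irrelevant, so later inductions may remove any convenient input. -/
theorem res_face (e : O.obj 0) {n : ℕ} (i : Fin (n + 1)) (j : Fin n) (θ : O.obj (n + 1)) :
    res e j (face e i θ) = res e (i.succAbove j) θ := by
  induction n with
  | zero => exact j.elim0
  | succ n ih =>
    rcases Fin.eq_castSucc_or_eq_last i with ⟨i, rfl⟩ | rfl
    · rcases Fin.eq_castSucc_or_eq_last j with ⟨j, rfl⟩ | rfl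
      · cases n with
        | zero => exact j.elim0
        | succ n =>
        rw [Fin.castSucc_succAbove_castSucc]
        rw [res_castSucc, res_castSucc, ← ih]
        rw [face_face e i.castSucc (Fin.last _) i (Fin.last _) (Fin.castSucc_lt_last i) rfl
          (by simp)]
      · rw [Fin.succAbove_castSucc_of_le _ _ (Fin.le_last i), Fin.succ_last, res_last]
        cases n with
        | zero => rw [Fin.fin_one_eq_zero i]; rfl
        | succ n =>
        rw [res_last]
        rcases Fin.eq_zero_or_eq_succ i with rfl | ⟨i, rfl⟩
        · rw [Fin.castSucc_zero, res_last]
        · rw [← face_face e 0 i.succ.castSucc 0 i.castSucc (by simp [Fin.lt_def]) rfl (by simp),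
            ih, Fin.succAbove_castSucc_of_le _ _ (Fin.le_last i), Fin.succ_last]
    · rw [Fin.succAbove_last, res_castSucc]

theorem succAbove_insertEquiv {n : ℕ} (i a : Fin (n + 1)) (ha : a ≠ i) :
    i.succAbove (insertEquiv (n := 0) (r := n) i rfl (Sum.inl ⟨a, ha⟩)) = a := by
  have h3 : (a : ℕ) ≠ i := fun e => ha (Fin.ext e)
  apply Fin.ext
  simp only [insertEquiv, Equiv.ofBijective_apply, insertPos, Fin.succAbove, Fin.lt_def,
    Fin.val_castSucc]
  split_ifs <;> simp <;> omega

/-- With an empty inner block, `outerPerm` is the bijection that `φ` induces between the complements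
of `i` and of `φ i`. -/
theorem succAbove_outerPerm {n : ℕ} (i : Fin (n + 1)) (φ : Equiv.Perm (Fin (n + 1))) (j : Fin n) :
    (φ i).succAbove (outerPerm (n := 0) (r := n) i rfl φ j) = φ (i.succAbove j) := by
  have hj : insertEquiv (n := 0) (r := n) i rfl (Sum.inl ⟨i.succAbove j, Fin.succAbove_ne i j⟩) = j :=
    Fin.succAbove_right_injective (succAbove_insertEquiv i _ _)
  have : (insertEquiv (n := 0) (r := n) i rfl).symm j
      = Sum.inl ⟨i.succAbove j, Fin.succAbove_ne i j⟩ := by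
    rw [Equiv.symm_apply_eq, hj]
  simp only [outerPerm, Equiv.trans_apply, this, Equiv.sumCongr_apply, Sum.map_inl]
  exact succAbove_insertEquiv _ _ _

theorem res_act (e : O.obj 0) {n : ℕ} (φ : Equiv.Perm (Fin n)) (j : Fin n) (θ : O.obj n) :
    res e j (O.act φ θ) = res e (φ j) θ := by
  induction n with
  | zero => exact j.elim0
  | succ n ih =>
    cases n with
    | zero => rw [show φ = 1 from Equiv.ext fun x => Subsingleton.elim (α := Fin 1) _ _, O.act_one]; rfl
    | succ n =>
      obtain ⟨i, hi⟩ := exists_ne j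
      obtain ⟨j, rfl⟩ := Fin.exists_succAbove_eq hi.symm
      rw [← res_face, face_act, ih, res_face, succAbove_outerPerm]

/-- The surplus inputs of `ν` are plugged first, turning `ν` into a unary operation; then those of
`μ` other than `i`, which leaves a product of unary operations. -/
theorem res_comp_inner (e : O.obj 0) {m n r : ℕ} (i : Fin m) (h : m + n = r + 1) (j : Fin n)
    (p : Fin r) (hp : (p : ℕ) = i + j) (μ : O.obj m) (ν : O.obj n) :
    res e p (O.comp i h μ ν) = O.comp (m := 1) (n := 1) (r := 1) 0 rfl (res e i μ) (res e j ν) := by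
  induction hN : m + n generalizing m n r with
  | zero => have := i.2; omega
  | succ N ih =>
    obtain _ | _ | n := n
    · exact j.elim0
    · obtain rfl : m = r := by omega
      obtain _ | _ | m := m
      · exact i.elim0
      · rw [Fin.fin_one_eq_zero i]; rfl
      · obtain ⟨q, hq⟩ := exists_ne i
        obtain ⟨i', rfl⟩ := Fin.exists_succAbove_eq hq.symm
        obtain rfl : p = q.succAbove i' := by apply Fin.ext; omega
        rw [← res_face, ← res_face e q i' μ]
        have key : face e q (O.comp (q.succAbove i') h μ ν)
            = O.comp i' (by omega) (face e q μ) ν := by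
          rcases lt_or_gt_of_ne hq with h1 | h1
          · refine face_comp_outer_left e _ _ h q q h1 ?_ rfl μ ν
            rw [Fin.succAbove_of_le_castSucc _ _ ((Fin.lt_succAbove_iff_le_castSucc _ _).1 h1)]
            simp
          · refine face_comp_outer_right e _ _ h q q h1 ?_ rfl μ ν
            rw [Fin.succAbove_of_castSucc_lt _ _ ((Fin.succAbove_lt_iff_castSucc_lt _ _).1 h1)]
            simp
        rw [key]
        exact ih _ _ _ _ (by omega) _ _ (by omega)
    · obtain ⟨r, rfl⟩ : ∃ s, r = s + 2 := ⟨r - 2, by have := i.2; omega⟩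
      obtain ⟨q, hq⟩ := exists_ne j
      obtain ⟨j', rfl⟩ := Fin.exists_succAbove_eq hq.symm
      obtain ⟨q', hq'⟩ : ∃ q' : Fin (r + 2), (q' : ℕ) = i + q := ⟨⟨i + q, by omega⟩, rfl⟩
      have hpq : p ≠ q' := fun hh => hq (Fin.ext (by
        have := congrArg Fin.val hh
        omega))
      obtain ⟨p', rfl⟩ := Fin.exists_succAbove_eq hpq
      rw [← res_face, face_comp_inner e i h q q' hq', ← res_face]
      refine ih _ _ _ _ ?_ _ _ (by omega)
      simp only [Fin.succAbove, Fin.lt_def, Fin.val_castSucc] at hp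
      split_ifs at hp <;> simp at hp <;> omega

/-- The scalar obtained by plugging the `0`-unit into all inputs. -/
noncomputable def IsZeroUnit.aug {e : O.obj 0} (he : O.IsZeroUnit e) : ∀ {n : ℕ}, O.obj n →ₗ[k] k
  | 0 => he.equiv.symm.toLinearMap
  | _ + 1 => he.aug ∘ₗ face e 0

/-! ### The augmentation in all arities, and restrictions at outer inputs -/

section aug

variable {e : O.obj 0} (he : O.IsZeroUnit e)

theorem IsZeroUnit.aug_face {n : ℕ} (i : Fin (n + 1)) (θ : O.obj (n + 1)) :
    he.aug (face e i θ) = he.aug θ := by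
  induction n with
  | zero => rw [Fin.fin_one_eq_zero i]; rfl
  | succ n ih =>
    rcases Fin.eq_zero_or_eq_succ i with rfl | ⟨i, rfl⟩
    · rfl
    · rw [← ih 0, ← face_face e 0 i.succ 0 i (Fin.succ_pos i) rfl (by simp), ih]
      rfl

theorem IsZeroUnit.aug_smul (x : O.obj 0) : he.aug x • e = x :=
  he.equiv_symm_smul x

theorem IsZeroUnit.aug_zeroUnit : he.aug e = 1 :=
  he.smul_injective ((he.aug_smul e).trans (one_smul k e).symm)

theorem IsZeroUnit.aug_one : he.aug O.one = 1 := by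
  rw [← he.aug_face 0, face_apply]
  exact (congrArg _ (O.one_comp e)).trans he.aug_zeroUnit

theorem IsZeroUnit.aug_res {n : ℕ} (j : Fin n) (θ : O.obj n) : he.aug (res e j θ) = he.aug θ := by
  induction n with
  | zero => exact j.elim0
  | succ n ih =>
    cases n with
    | zero => rfl
    | succ n =>
      obtain ⟨i, hi⟩ := exists_ne j
      obtain ⟨j, rfl⟩ := Fin.exists_succAbove_eq hi.symm
      rw [← res_face, ih, he.aug_face]

theorem IsZeroUnit.comp_nullary {n : ℕ} (i : Fin (n + 1)) (h : n + 1 + 0 = n + 1)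
    (μ : O.obj (n + 1)) (ν : O.obj 0) : O.comp i h μ ν = he.aug ν • face e i μ := by
  conv_lhs => rw [← he.aug_smul ν, map_smul]
  rfl

theorem IsZeroUnit.aug_comp {m n r : ℕ} (i : Fin m) (h : m + n = r + 1) (μ : O.obj m)
    (ν : O.obj n) : he.aug (O.comp i h μ ν) = he.aug μ * he.aug ν := by
  induction n generalizing r with
  | zero =>
    obtain rfl : m = r + 1 := h
    rw [he.comp_nullary, map_smul, he.aug_face, smul_eq_mul, mul_comm]
  | succ n ih =>
    obtain _ | r := r
    · have := i.2; omega
    · rw [← he.aug_face ⟨i, by omega⟩, face_comp_inner e i h 0 _ rfl, ih, he.aug_face]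

/-- All inputs of `ν` get plugged, so `ν` collapses to `ε(ν) e`, and `e` then sits in the input `i`
of `μ`. -/
theorem IsZeroUnit.res_comp_outer {m n r : ℕ} (i : Fin m) (h : m + n = r + 1) (a : Fin m)
    (ha : a ≠ i) (p : Fin r) (hp : (p : ℕ) = if a < i then (a : ℕ) else a + n - 1) (μ : O.obj m)
    (ν : O.obj n) : res e p (O.comp i h μ ν) = he.aug ν • res e a μ := by
  have h3 : (a : ℕ) ≠ i := fun e => ha (Fin.ext e)
  induction n generalizing r with
  | zero =>
    obtain rfl : m = r + 1 := h
    rw [he.comp_nullary, map_smul, res_face]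
    congr 3
    apply Fin.ext
    simp only [Fin.succAbove, Fin.lt_def, Fin.val_castSucc] at hp ⊢
    split_ifs at hp ⊢ <;> simp <;> omega
  | succ n ih =>
    obtain ⟨r, rfl⟩ : ∃ s, r = s + 2 := ⟨r - 2, by omega⟩
    obtain ⟨q, hq⟩ : ∃ q : Fin (r + 2), (q : ℕ) = i := ⟨⟨i, by omega⟩, rfl⟩
    have hpq : p ≠ q := fun hh => by
      simp only [hh, hq, Fin.lt_def] at hp
      split_ifs at hp <;> omega
    obtain ⟨p, rfl⟩ := Fin.exists_succAbove_eq hpq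
    rw [← res_face, face_comp_inner e i h 0 q (by simpa using hq), ih, he.aug_face]
    simp only [Fin.succAbove, Fin.lt_def, Fin.val_castSucc] at hp ⊢
    split_ifs at hp ⊢ <;> simp at hp <;> omega

theorem exists_insertPos {m n r : ℕ} (i : Fin m) (h : m + n = r + 1) (p : Fin r) :
    (∃ j : Fin n, (p : ℕ) = i + j) ∨
      ∃ a : Fin m, a ≠ i ∧ (p : ℕ) = if a < i then (a : ℕ) else a + n - 1 := by
  obtain ⟨⟨a, ha⟩ | j, rfl⟩ := (insertPos_bijective i h).2 p
  · exact Or.inr ⟨a, ha, rfl⟩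
  · exact Or.inl ⟨j, rfl⟩

end aug

/-! ## Growth of a 2-unitary operad -/

/-- The operations that vanish when `e` is plugged into one of the inputs in `S`. -/
def faceKer (e : O.obj 0) {n : ℕ} (S : Finset (Fin (n + 1))) : Submodule k (O.obj (n + 1)) :=
  ⨅ i ∈ S, LinearMap.ker (face e i)

theorem mem_faceKer {e : O.obj 0} {n : ℕ} {S : Finset (Fin (n + 1))} {θ : O.obj (n + 1)} :
    θ ∈ faceKer e S ↔ ∀ i ∈ S, face e i θ = 0 := by
  simp [faceKer]

/-- Thus `w ∘₁ -` is a section of the last face, because `w ∘₂ e = 1`. -/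
theorem IsTwoUnit.face_last_comp {e : O.obj 0} {w : O.obj 2} (hw : O.IsTwoUnit e w) {n : ℕ}
    (ψ : O.obj (n + 1)) :
    face e (Fin.last (n + 1)) (O.comp 0 (by omega : 2 + (n + 1) = n + 1 + 1 + 1) w ψ) = ψ := by
  rw [face_comp_outer_right (m := 1) e 0 0 _ 1 _ (by simp) rfl (by simp; omega), face_apply,
    hw.2]
  exact O.one_comp ψ

/-- Applied to `φ` and its inverse, this says that the rank depends only on the size of `S`. -/
theorem rank_faceKer_map_le (e : O.obj 0) {n : ℕ} (φ : Equiv.Perm (Fin (n + 1)))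
    (S : Finset (Fin (n + 1))) :
    Module.rank k (faceKer e (S.map φ.toEmbedding)) ≤ Module.rank k (faceKer e S) := by
  refine LinearMap.rank_le_of_injective ((O.act φ).restrict ?_) ?_
  · intro θ hθ
    rw [mem_faceKer] at hθ ⊢
    intro i hi
    rw [face_act, hθ (φ i) (by simpa using hi), map_zero]
  · intro x y hxy
    exact Subtype.ext (act_injective φ (congrArg Subtype.val hxy))

/-- Rank–nullity for `g` restricted to `K`: its range contains `L` and its kernel contains `K'`. -/
theorem rank_add_rank_le {M N : Type v} [AddCommGroup M] [Module k M] [AddCommGroup N] [Module k N]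
    (g : M →ₗ[k] N) (K K' : Submodule k M) (L : Submodule k N) (hle : K' ≤ K)
    (h0 : ∀ θ ∈ K', g θ = 0) (hsec : ∀ ψ ∈ L, ∃ θ ∈ K, g θ = ψ) :
    Module.rank k L + Module.rank k K' ≤ Module.rank k K := by
  rw [← LinearMap.rank_range_add_rank_ker (g.domRestrict K)]
  refine add_le_add (Submodule.rank_mono fun ψ hψ => ?_) ?_
  · obtain ⟨θ, hθ, h⟩ := hsec ψ hψ
    exact ⟨⟨θ, hθ⟩, h⟩
  · have hker : ∀ x : K', Submodule.inclusion hle x ∈ LinearMap.ker (g.domRestrict K) :=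
      fun x => LinearMap.mem_ker.2 (h0 x.1 x.2)
    refine LinearMap.rank_le_of_injective (LinearMap.codRestrict _ (Submodule.inclusion hle) hker) ?_
    rw [LinearMap.injective_codRestrict_iff]
    exact Submodule.inclusion_injective hle

theorem comp_mem_faceKer (e : O.obj 0) (w : O.obj 2) {n : ℕ}
    {S : Finset (Fin (n + 1))} {ψ : O.obj (n + 1)} (hψ : ψ ∈ faceKer e S) :
    O.comp 0 (by omega : 2 + (n + 1) = n + 1 + 1 + 1) w ψ ∈ faceKer e (S.map Fin.castSuccEmb) := by
  rw [mem_faceKer] at hψ ⊢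
  intro i hi
  obtain ⟨j, hj, rfl⟩ := Finset.mem_map.1 hi
  have hp : ((Fin.castSuccEmb j : Fin (n + 2)) : ℕ) = ((0 : Fin 2) : ℕ) + (j : ℕ) := by simp
  rw [face_comp_inner e 0 _ j _ hp, hψ j hj, map_zero]

theorem IsTwoUnit.rank_faceKer_add_le {e : O.obj 0} {w : O.obj 2} (hw : O.IsTwoUnit e w) {n : ℕ}
    (S : Finset (Fin (n + 1))) :
    Module.rank k (faceKer e S)
        + Module.rank k (faceKer e (insert (Fin.last (n + 1)) (S.map Fin.castSuccEmb)))
      ≤ Module.rank k (faceKer e (S.map Fin.castSuccEmb)) :=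
  rank_add_rank_le (face e (Fin.last (n + 1))) _ _ _
    (fun _ hθ => mem_faceKer.2 fun i hi => mem_faceKer.1 hθ i (Finset.mem_insert_of_mem hi))
    (fun _ hθ => mem_faceKer.1 hθ _ (Finset.mem_insert_self _ _))
    (fun ψ hψ => ⟨_, comp_mem_faceKer e w hψ, hw.face_last_comp ψ⟩)

/-- Here `d` counts the inputs outside `S`. Splitting off the last face either deletes a free input
or moves it into `S`; these are the two terms of Pascal's rule. The recursion ends at `θ` itself,
with `S` all of its `m + 1` inputs. -/
theorem IsTwoUnit.choose_le_rank_faceKer {e : O.obj 0} {w : O.obj 2} (hw : O.IsTwoUnit e w) {m : ℕ}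
    (hm : 1 ≤ m) {θ : O.obj (m + 1)} (hθ : θ ≠ 0) (hface : ∀ i, face e i θ = 0) (d : ℕ) {n : ℕ}
    (S : Finset (Fin (n + 1))) (hS : S.card ≤ m + 1) (hd : n + 1 = S.card + d) :
    (d.choose (m + 1 - S.card) : Cardinal) ≤ Module.rank k (faceKer e S) := by
  induction d generalizing n with
  | zero =>
    rcases hS.lt_or_eq with h | h
    · rw [Nat.choose_eq_zero_of_lt (by omega)]
      simp
    · obtain rfl : m = n := by omega
      rw [h, Nat.sub_self, Nat.choose_self, Nat.cast_one, Cardinal.one_le_iff_ne_zero, Ne,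
        rank_zero_iff]
      intro hsub
      have := congrArg Subtype.val (Subsingleton.elim
        (⟨θ, mem_faceKer.2 fun i _ => hface i⟩ : faceKer e S) 0)
      exact hθ this
  | succ d ih =>
    obtain ⟨x, hx⟩ : ∃ x, x ∉ S := by
      by_contra! h
      have := Finset.card_fin (n + 1)
      rw [← Finset.eq_univ_iff_forall.2 h] at this
      omega
    -- A transposition makes the last input a free one.
    refine le_trans ?_ (rank_faceKer_map_le e (Equiv.swap x (Fin.last n)) S)
    have hS' : Fin.last n ∉ S.map (Equiv.swap x (Fin.last n)).toEmbedding := by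
      simpa [Finset.mem_map_equiv] using hx
    have hc : (S.map (Equiv.swap x (Fin.last n)).toEmbedding).card = S.card := Finset.card_map _
    rw [← hc] at hS hd ⊢
    generalize S.map (Equiv.swap x (Fin.last n)).toEmbedding = T at *
    obtain _ | n := n
    · rw [Nat.choose_eq_zero_of_lt (by omega)]
      simp
    obtain ⟨U, rfl⟩ : ∃ U : Finset (Fin (n + 1)), T = U.map Fin.castSuccEmb := by
      refine ⟨Finset.univ.filter fun i => i.castSucc ∈ T, ?_⟩
      ext i
      simp only [Finset.mem_map, Finset.mem_filter_univ, Fin.coe_castSuccEmb]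
      refine ⟨fun hi => ?_, ?_⟩
      · have : i ≠ Fin.last _ := fun h => hS' (h ▸ hi)
        exact ⟨i.castPred this, by simpa using hi, by simp⟩
      · rintro ⟨j, hj, rfl⟩
        exact hj
    refine le_trans ?_ (hw.rank_faceKer_add_le U)
    have hU : (U.map Fin.castSuccEmb).card = U.card := Finset.card_map _
    have hI : (insert (Fin.last (n + 1)) (U.map Fin.castSuccEmb)).card = U.card + 1 := by
      rw [Finset.card_insert_of_notMem hS', hU]
    rw [hU] at hS hd ⊢
    have h1 := ih U hS (by omega)
    rcases hS.lt_or_eq with h | h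
    · have h2 := ih (insert (Fin.last (n + 1)) (U.map Fin.castSuccEmb)) (by omega) (by omega)
      rw [hI] at h2
      obtain ⟨t, ht⟩ : ∃ t, m + 1 - U.card = t + 1 := ⟨m - U.card, by omega⟩
      rw [show m + 1 - (U.card + 1) = t by omega] at h2
      rw [ht] at h1 ⊢
      rw [Nat.choose_succ_succ', Nat.cast_add, add_comm]
      exact add_le_add h1 h2
    -- When `S` already has `m + 1` elements the bound is 1, and the first summand suffices.
    · rw [h, Nat.sub_self, Nat.choose_zero_right] at h1 ⊢
      exact h1.trans (self_le_add_right _ _)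

theorem IsTwoUnit.choose_le_rank {e : O.obj 0} {w : O.obj 2} (hw : O.IsTwoUnit e w) {m : ℕ}
    (hm : 1 ≤ m) {θ : O.obj (m + 1)} (hθ : θ ≠ 0) (hface : ∀ i, face e i θ = 0) (n : ℕ) :
    (n.choose (m + 1) : Cardinal) ≤ Module.rank k (O.obj n) := by
  cases n with
  | zero => simp
  | succ n =>
    have := hw.choose_le_rank_faceKer hm hθ hface (n + 1) (n := n) ∅ (by simp) (by simp)
    exact this.trans (Submodule.rank_le _)

/-! ### From binomial bounds to Gelfand–Kirillov dimension -/

theorem choose_le_growth {m : ℕ}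
    (h : ∀ n : ℕ, (n.choose m : Cardinal) ≤ Module.rank k (O.obj n)) (n : ℕ) :
    ((n + 1).choose (m + 1) : ENNReal) ≤ O.growth n := by
  have h1 : (n + 1).choose (m + 1) = ∑ i ∈ Finset.range (n + 1), i.choose m := by
    induction n with
    | zero => cases m <;> simp [Nat.choose_succ_succ']
    | succ n ih => rw [Finset.sum_range_succ, ← ih, Nat.choose_succ_succ', add_comm]
  rw [h1, Nat.cast_sum]
  refine Finset.sum_le_sum fun i _ => ?_
  have h2 : ((i.choose m : ℕ) : ℕ∞) ≤ Cardinal.toENat (Module.rank k (O.obj i)) := by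
    simpa using OrderHomClass.mono Cardinal.toENat (h i)
  exact_mod_cast h2

/-- The binomial has degree `m + 1 ≥ 3` in `n`. The exponent `5 / 2` lies strictly between 2 and 3,
leaving a factor `n ^ (1 / 2)` to absorb the constant. -/
theorem eventually_rpow_le_choose {m : ℕ} (hm : 2 ≤ m) :
    ∀ᶠ n : ℕ in Filter.atTop, (n : ℝ) ^ (5 / 2 : ℝ) ≤ ((n + 1).choose (m + 1) : ℝ) := by
  -- The factorial is the denominator of the binomial bound; the power of 2 comes from `n + 1 - m ≥
  -- n / 2`.
  set c : ℝ := 2 ^ (m + 1) * (m + 1).factorial with hc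
  have hc0 : 0 < c := by positivity
  filter_upwards [Filter.eventually_ge_atTop (2 * m + 1),
    Filter.eventually_ge_atTop (Nat.ceil (c ^ 2))] with n h1 h2
  have hn : (1 : ℝ) ≤ n := by exact_mod_cast (by omega : 1 ≤ n)
  have hcn : c ≤ (n : ℝ) ^ (1 / 2 : ℝ) := by
    rw [← Real.sqrt_eq_rpow]
    exact Real.le_sqrt_of_sq_le (Nat.ceil_le.1 h2)
  have h3 := Nat.pow_le_choose (α := ℝ) (m + 1) (n + 1)
  refine le_trans ?_ h3
  rw [le_div_iff₀ (by positivity)]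
  have h4 : (n : ℝ) / 2 ≤ ((n + 1 + 1 - (m + 1) : ℕ) : ℝ) := by
    rw [div_le_iff₀ (by norm_num)]
    exact_mod_cast (by omega : n ≤ (n + 1 + 1 - (m + 1)) * 2)
  have h5 : ((n : ℝ) / 2) ^ (m + 1) ≤ ((n + 1 + 1 - (m + 1) : ℕ) : ℝ) ^ (m + 1) :=
    pow_le_pow_left₀ (by positivity) h4 _
  refine le_trans ?_ h5
  rw [div_pow, le_div_iff₀ (by positivity), mul_assoc, mul_comm ((m + 1).factorial : ℝ), ← hc]
  calc (n : ℝ) ^ (5 / 2 : ℝ) * c ≤ (n : ℝ) ^ (5 / 2 : ℝ) * (n : ℝ) ^ (1 / 2 : ℝ) := by gcongr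
    _ = (n : ℝ) ^ 3 := by
      rw [← Real.rpow_add (by linarith), ← Real.rpow_natCast]
      norm_num
    _ ≤ (n : ℝ) ^ (m + 1) := pow_le_pow_right₀ hn (by omega)

theorem two_lt_GKdim {m : ℕ} (hm : 2 ≤ m)
    (h : ∀ n : ℕ, (n.choose m : Cardinal) ≤ Module.rank k (O.obj n)) : 2 < O.GKdim := by
  refine lt_of_lt_of_le (b := (((5 / 2 : ℝ) : ℝ) : EReal)) ?_ ?_
  · have : ((2 : ℝ) : EReal) < ((5 / 2 : ℝ) : EReal) := EReal.coe_lt_coe_iff.2 (by norm_num)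
    exact this
  · refine Filter.le_limsup_of_frequently_le' (Filter.Eventually.frequently ?_)
    filter_upwards [eventually_rpow_le_choose hm, Filter.eventually_ge_atTop 2] with n h1 h2
    have hn : (0 : ℝ) < n := by exact_mod_cast (by omega : 0 < n)
    have h3 : (n : ENNReal) ^ (5 / 2 : ℝ) ≤ O.growth n := by
      refine le_trans ?_ (choose_le_growth h n)
      have := ENNReal.ofReal_le_ofReal h1
      rwa [← ENNReal.ofReal_rpow_of_pos hn, ENNReal.ofReal_natCast, ENNReal.ofReal_natCast] at this
    have h4 := ENNReal.log_le_log h3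
    rw [ENNReal.log_rpow] at h4
    have h5 : 0 < ENNReal.log (n : ENNReal) := by
      rw [ENNReal.zero_lt_log_iff]
      exact_mod_cast (by omega : 1 < n)
    have h6 : ENNReal.log (n : ENNReal) ≠ ⊤ := by
      rw [Ne, ENNReal.log_eq_top_iff]
      exact ENNReal.natCast_ne_top n
    exact (EReal.le_div_iff_mul_le h5 h6).2 h4

/-- The growth hypothesis acts only through this consequence. -/
theorem IsTwoUnit.eq_zero_of_face_eq_zero {e : O.obj 0} {w : O.obj 2} (hw : O.IsTwoUnit e w)
    (hGK : O.GKdim = 2) {n : ℕ} (θ : O.obj (n + 2)) (hface : ∀ i, face e i θ = 0) : θ = 0 := by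
  by_contra hθ
  exact (two_lt_GKdim (by omega) (hw.choose_le_rank (by omega) hθ hface)).ne' hGK

/-- An operation is determined by its restrictions to single inputs. -/
theorem IsTwoUnit.ext_res {e : O.obj 0} {w : O.obj 2} (hw : O.IsTwoUnit e w)
    (hGK : O.GKdim = 2) {n : ℕ} (hn : n ≠ 0) {θ η : O.obj n} (h : ∀ j, res e j θ = res e j η) :
    θ = η := by
  rw [← sub_eq_zero]
  replace h : ∀ j, res e j (θ - η) = 0 := fun j => by rw [map_sub, h, sub_self]
  generalize θ - η = ζ at h
  induction n with
  | zero => exact absurd rfl hn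
  | succ n ih =>
    obtain _ | n := n
    · exact h 0
    · refine hw.eq_zero_of_face_eq_zero hGK ζ fun i => ?_
      exact ih (by omega) (θ := 0) (η := 0) _ fun j => by rw [res_face, h]

end SymmOperad

/-! ## Two general facts -/

/-- A derivation of the augmentation ideal extends to the algebra. -/
theorem AlgDer.exists_extension {k A : Type*} [Field k] [Ring A] [Algebra k A] (ε : A →ₐ[k] k)
    (I : NonUnitalSubalgebra k A) (hI : ∀ x, x ∈ I ↔ ε x = 0) (D : AlgDer k I) :
    ∃ d : A →ₗ[k] A, (∀ x, ε (d x) = 0) ∧ (∀ x y, d (x * y) = d x * y + x * d y) ∧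
      ∀ a : I, d a = (D.1 a : I) := by
  have hp : ∀ x, x - ε x • (1 : A) ∈ I := fun x => by
    rw [hI, map_sub, map_smul, map_one, smul_eq_mul, mul_one, sub_self]
  -- Projection onto `I` along the scalars; `D ∘ p` is the extension of `D` that kills `1`.
  let p : A →ₗ[k] I :=
    { toFun := fun x => ⟨x - ε x • (1 : A), hp x⟩
      map_add' := fun x y => Subtype.ext (by
        simp only [map_add, add_smul, NonUnitalSubalgebra.coe_add]; abel)
      map_smul' := fun c x => Subtype.ext (by
        simp only [map_smul, smul_assoc, RingHom.id_apply, NonUnitalSubalgebra.coe_smul, smul_sub]) }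
  have hpx : ∀ x, (p x : A) = x - ε x • (1 : A) := fun _ => rfl
  have hpi : ∀ a : I, p a = a := fun a => Subtype.ext (by
    rw [hpx, (hI a).1 a.2, zero_smul, sub_zero])
  have hpm : ∀ x y, p (x * y) = p x * p y + ε x • p y + ε y • p x := fun x y => Subtype.ext (by
    simp only [NonUnitalSubalgebra.coe_add, NonUnitalSubalgebra.coe_mul,
      NonUnitalSubalgebra.coe_smul, hpx, map_mul, mul_sub, sub_mul, smul_sub, mul_smul_comm,
      smul_mul_assoc, mul_one, one_mul, smul_smul]
    rw [mul_comm (ε y)]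
    abel)
  refine ⟨I.toSubmodule.subtype ∘ₗ D.1 ∘ₗ p, fun x => (hI _).1 (D.1 (p x)).2, fun x y => ?_,
    fun a => ?_⟩
  · change ((D.1 (p (x * y)) : I) : A) = ((D.1 (p x) : I) : A) * y + x * ((D.1 (p y) : I) : A)
    have hx : x = (p x : A) + ε x • (1 : A) := by rw [hpx, sub_add_cancel]
    have hy : y = (p y : A) + ε y • (1 : A) := by rw [hpx, sub_add_cancel]
    have h1 : ((D.1 (p x) : I) : A) * y = (D.1 (p x) : I) * p y + ε y • ((D.1 (p x) : I) : A) := by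
      conv_lhs => rw [hy, mul_add, mul_smul_comm, mul_one]
    have h2 : x * ((D.1 (p y) : I) : A) = p x * (D.1 (p y) : I) + ε x • ((D.1 (p y) : I) : A) := by
      conv_lhs => rw [hx, add_mul, smul_mul_assoc, one_mul]
    rw [hpm, map_add, map_add, map_smul, map_smul, D.2 (p x) (p y), h1, h2]
    simp only [NonUnitalSubalgebra.coe_add, NonUnitalSubalgebra.coe_mul,
      NonUnitalSubalgebra.coe_smul]
    abel
  · change ((D.1 (p a) : I) : A) = _
    rw [hpi]

/-- A surjective morphism of Lie algebras induces an isomorphism between the quotients by an ideal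
and by its inverse image. -/
theorem LieHom.exists_quotient_equiv {k L L' : Type*} [CommRing k] [LieRing L] [LieAlgebra k L]
    [LieRing L'] [LieAlgebra k L'] (f : L →ₗ⁅k⁆ L') (hf : Function.Surjective f) (I : LieIdeal k L)
    (J : LieIdeal k L') (h : ∀ x, x ∈ I ↔ f x ∈ J) :
    ∃ g : (L ⧸ I) ≃ₗ⁅k⁆ (L' ⧸ J), ∀ x,
      g (LieSubmodule.Quotient.mk x) = LieSubmodule.Quotient.mk (f x) := by
  let q : (L ⧸ I) →ₗ[k] (L' ⧸ J) :=
    Submodule.mapQ I.toSubmodule J.toSubmodule f.toLinearMap fun x hx => (h x).1 hx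
  have hq : ∀ x : L, q (LieSubmodule.Quotient.mk x) = LieSubmodule.Quotient.mk (f x) :=
    fun _ => rfl
  have hb : Function.Bijective q := by
    constructor
    · rw [injective_iff_map_eq_zero]
      intro x hx
      induction x using Submodule.Quotient.induction_on with | _ x
      rw [hq, LieSubmodule.Quotient.mk_eq_zero', ← h] at hx
      exact LieSubmodule.Quotient.mk_eq_zero'.2 hx
    · intro y
      induction y using Submodule.Quotient.induction_on with | _ y
      obtain ⟨x, rfl⟩ := hf y
      exact ⟨_, hq x⟩
  refine ⟨{ LinearEquiv.ofBijective q hb with map_lie' := ?_ }, hq⟩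
  intro x y
  induction x using Submodule.Quotient.induction_on with | _ x
  induction y using Submodule.Quotient.induction_on with | _ y
  change q _ = ⁅q _, q _⁆
  rw [hq, hq, ← LieSubmodule.Quotient.mk_bracket, ← LieSubmodule.Quotient.mk_bracket, hq,
    LieHom.map_lie]

namespace SymmOperad

variable {k : Type u} [Field k] {O : SymmOperad.{u, v} k}

/-! ## Derivations and restrictions -/

theorem IsZeroUnit.eq_zero_of_aug_eq_zero {e : O.obj 0} (he : O.IsZeroUnit e) {x : O.obj 0}
    (h : he.aug x = 0) : x = 0 := by
  rw [← he.aug_smul x, h, zero_smul]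

theorem IsZeroUnit.mem_augIdeal {e : O.obj 0} (he : O.IsZeroUnit e) {x : O.Unary} :
    x ∈ he.augIdeal ↔ he.aug (n := 1) x = 0 := Iff.rfl

theorem der_map_comp (D : O.Der) {m n r : ℕ} (i : Fin m) (h : m + n = r + 1) (μ : O.obj m)
    (ν : O.obj n) :
    D.1 r (O.comp i h μ ν) = O.comp i h (D.1 m μ) ν + O.comp i h μ (D.1 n ν) :=
  D.2.2 m n r i h μ ν

theorem der_map_one (D : O.Der) : D.1 1 O.one = 0 := by
  have h := der_map_comp D (m := 1) (n := 1) (r := 1) 0 rfl O.one O.one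
  have h1 : ∀ x : O.obj 1, O.comp (m := 1) (n := 1) (r := 1) 0 rfl O.one x = x := O.one_comp
  rw [h1, h1, O.comp_one] at h
  simpa using h

/-- The eigenvalue of a derivation on the space of nullary operations, with the opposite sign. -/
noncomputable def IsZeroUnit.weight {e : O.obj 0} (he : O.IsZeroUnit e) : O.Der →ₗ[k] k where
  -- Scaling by `(n - 1) c` acts on arity 0 as `-c`; the sign makes its weight `c`.
  toFun D := -he.aug (D.1 0 e)
  map_add' D E := by
    have h : (D + E).1 0 e = D.1 0 e + E.1 0 e := rfl
    rw [h, map_add, neg_add]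
  map_smul' c D := by
    have h : (c • D).1 0 e = c • D.1 0 e := rfl
    rw [h, map_smul, smul_neg]
    rfl

theorem IsZeroUnit.map_nullary {e : O.obj 0} (he : O.IsZeroUnit e) (D : O.Der) (x : O.obj 0) :
    D.1 0 x = -he.weight D • x := by
  conv_lhs => rw [← he.aug_smul x, map_smul, ← he.aug_smul (D.1 0 e)]
  conv_rhs => rw [← he.aug_smul x]
  rw [smul_comm]
  simp [IsZeroUnit.weight]

theorem IsZeroUnit.face_map {e : O.obj 0} (he : O.IsZeroUnit e) (D : O.Der) {n : ℕ}
    (i : Fin (n + 1)) (θ : O.obj (n + 1)) :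
    face e i (D.1 (n + 1) θ) = D.1 n (face e i θ) + he.weight D • face e i θ := by
  rw [face_apply, face_apply, der_map_comp D, he.map_nullary, map_smul, neg_smul, neg_add_cancel_right]

/-- Each of the `n - 1` plugged inputs contributes the weight once, through `D e`. -/
theorem IsZeroUnit.res_map {e : O.obj 0} (he : O.IsZeroUnit e) (D : O.Der) {n : ℕ} (j : Fin n)
    (θ : O.obj n) :
    res e j (D.1 n θ) = D.1 1 (res e j θ) + (((n : k) - 1) * he.weight D) • res e j θ := by
  induction n with
  | zero => exact j.elim0
  | succ n ih =>
    obtain _ | n := n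
    · simp [res_one]
    · obtain ⟨i, hi⟩ := exists_ne j
      obtain ⟨j, rfl⟩ := Fin.exists_succAbove_eq hi.symm
      rw [← res_face, ← res_face, he.face_map, map_add, ih, map_smul, add_assoc, ← add_smul]
      congr 2
      push_cast
      ring

theorem IsZeroUnit.aug_map_unary {e : O.obj 0} (he : O.IsZeroUnit e) (D : O.Der) (x : O.obj 1) :
    he.aug (D.1 1 x) = 0 := by
  rw [← he.aug_face 0, he.face_map, he.map_nullary, neg_smul, neg_add_cancel, map_zero]

/-- The derivation that multiplies `O(n)` by `(n - 1) c`. -/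
def scalingDer (O : SymmOperad.{u, v} k) (c : k) : O.Der :=
  ⟨fun n => (((n : k) - 1) * c) • LinearMap.id, by
    refine ⟨fun n σ θ => by simp, fun m n r i h μ ν => ?_⟩
    -- Additivity of arity minus one, `(m - 1) + (n - 1) = r - 1`, is the Leibniz rule here.
    have h' : (m : k) + n = r + 1 := by exact_mod_cast congrArg (Nat.cast : ℕ → k) h
    simp only [LinearMap.smul_apply, LinearMap.id_apply, map_smul, ← add_smul]
    congr 1
    linear_combination -c * h'⟩

theorem scalingDer_apply (c : k) (n : ℕ) (θ : O.obj n) :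
    (scalingDer O c).1 n θ = (((n : k) - 1) * c) • θ := rfl

theorem der_ext_apply {D E : O.Der} (h : ∀ n θ, D.1 n θ = E.1 n θ) : D = E :=
  Subtype.ext (funext fun n => LinearMap.ext (h n))

theorem der_lie_apply (D E : O.Der) (n : ℕ) (θ : O.obj n) :
    (⁅D, E⁆ : O.Der).1 n θ = D.1 n (E.1 n θ) - E.1 n (D.1 n θ) := rfl

/-- The inclusion of the scaling derivations. -/
def scalingHom (O : SymmOperad.{u, v} k) : k →ₗ⁅k⁆ O.Der where
  toFun := scalingDer O
  map_add' c d := der_ext_apply fun n θ => by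
    have h : (scalingDer O c + scalingDer O d).1 n θ
      = (scalingDer O c).1 n θ + (scalingDer O d).1 n θ := rfl
    rw [h]
    simp only [scalingDer_apply, ← add_smul, mul_add]
  map_smul' c d := der_ext_apply fun n θ => by
    have h : (c • scalingDer O d).1 n θ = c • (scalingDer O d).1 n θ := rfl
    rw [RingHom.id_apply, h]
    simp only [scalingDer_apply, smul_smul, smul_eq_mul]
    congr 1
    ring
  map_lie' {c d} := der_ext_apply fun n θ => by
    rw [der_lie_apply]
    simp only [scalingDer_apply, Ring.lie_def, smul_smul]
    rw [← sub_smul]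
    congr 1
    ring

theorem scalingHom_apply (c : k) (n : ℕ) (θ : O.obj n) :
    (scalingHom O c).1 n θ = (((n : k) - 1) * c) • θ := rfl

/-- Restriction of derivations to the augmentation ideal. -/
noncomputable def IsZeroUnit.restrictHom {e : O.obj 0} (he : O.IsZeroUnit e) :
    O.Der →ₗ⁅k⁆ AlgDer k he.augIdeal where
  toFun D :=
    ⟨{ toFun := fun a => ⟨D.1 1 a.1, he.mem_augIdeal.2 (he.aug_map_unary D a.1)⟩
       map_add' := fun a b => Subtype.ext ((D.1 1).map_add a.1 b.1)
       map_smul' := fun c a => Subtype.ext ((D.1 1).map_smul c a.1) },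
      fun a b => Subtype.ext (der_map_comp D (m := 1) (n := 1) (r := 1) 0 rfl a.1 b.1)⟩
  map_add' _ _ := rfl
  map_smul' _ _ := rfl
  map_lie' := rfl

theorem IsZeroUnit.restrictHom_apply {e : O.obj 0} (he : O.IsZeroUnit e) (D : O.Der)
    (a : he.augIdeal) : (((he.restrictHom D).1 a : he.augIdeal) : O.Unary) = D.1 1 a.1 := rfl

theorem IsZeroUnit.weight_scalingHom {e : O.obj 0} (he : O.IsZeroUnit e) (c : k) :
    he.weight (scalingHom O c) = c := by
  change -he.aug ((scalingHom O c).1 0 e) = c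
  rw [scalingHom_apply, map_smul, he.aug_zeroUnit]
  simp

theorem IsZeroUnit.restrictHom_scalingHom {e : O.obj 0} (he : O.IsZeroUnit e) (c : k) :
    he.restrictHom (scalingHom O c) = 0 := by
  refine Subtype.ext (LinearMap.ext fun a => Subtype.ext ?_)
  refine (he.restrictHom_apply _ a).trans ((scalingHom_apply c 1 _).trans ?_)
  rw [Nat.cast_one, sub_self, zero_mul]
  exact zero_smul k (show O.obj 1 from a.1)

/-- Endomorphisms of the one-dimensional space of nullary operations commute. -/
theorem IsZeroUnit.weight_lie {e : O.obj 0} (he : O.IsZeroUnit e) (D E : O.Der) :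
    he.weight ⁅D, E⁆ = 0 := by
  change -he.aug (⁅D, E⁆.1 0 e) = 0
  rw [der_lie_apply, he.map_nullary D, he.map_nullary E, he.map_nullary E, he.map_nullary D,
    smul_comm, sub_self, map_zero, neg_zero]

theorem IsZeroUnit.sub_aug_mem {e : O.obj 0} (he : O.IsZeroUnit e) (x : O.obj 1) :
    he.aug (x - he.aug x • O.one) = 0 := by
  rw [map_sub, map_smul, he.aug_one, smul_eq_mul, mul_one, sub_self]

theorem IsZeroUnit.map_unary_eq {e : O.obj 0} (he : O.IsZeroUnit e) (D : O.Der) (x : O.obj 1) :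
    D.1 1 x = ((he.restrictHom D).1 ⟨x - he.aug x • O.one, he.sub_aug_mem x⟩ : he.augIdeal).1 := by
  rw [he.restrictHom_apply]
  change D.1 1 x = D.1 1 (x - he.aug x • O.one)
  rw [map_sub, map_smul, der_map_one D, smul_zero, sub_zero]

/-! ### Determining, lifting and recognising inner derivations -/

section

variable {e : O.obj 0} (he : O.IsZeroUnit e) {w : O.obj 2}

theorem IsTwoUnit.der_ext (hw : O.IsTwoUnit e w) (hGK : O.GKdim = 2) {D E : O.Der}
    (h0 : he.weight D = he.weight E) (h1 : he.restrictHom D = he.restrictHom E) : D = E := by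
  refine der_ext_apply fun n θ => ?_
  rcases Nat.eq_zero_or_pos n with rfl | hn
  · rw [he.map_nullary, he.map_nullary, h0]
  · refine hw.ext_res hGK hn.ne' fun j => ?_
    rw [he.res_map, he.res_map, he.map_unary_eq D, he.map_unary_eq E, h0, h1]

/-- There are operations of all positive arities whose restrictions are the identity. -/
theorem IsTwoUnit.exists_units (hw : O.IsTwoUnit e w) (he : O.IsZeroUnit e) (n : ℕ) :
    ∃ x : O.obj n, ∀ j, res e j x = O.one := by
  induction n with
  | zero => exact ⟨e, fun j => j.elim0⟩
  | succ n ih =>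
    obtain _ | n := n
    · exact ⟨O.one, fun _ => rfl⟩
    obtain ⟨x, hx⟩ := ih
    have h1 : ∀ y : O.obj 1, O.comp (m := 1) (n := 1) (r := 1) 0 rfl O.one y = y := O.one_comp
    have hw0 : res e 0 w = O.one := hw.2
    -- The indices cross: restricting to one input of `w` means plugging the other.
    have hw1 : res e 1 w = O.one := hw.1
    have hx1 : he.aug x = 1 := by rw [← he.aug_res 0, hx, he.aug_one]
    refine ⟨O.comp 0 (by omega : 2 + (n + 1) = n + 1 + 1 + 1) w x, fun p => ?_⟩
    rcases exists_insertPos (0 : Fin 2) (by omega : 2 + (n + 1) = n + 1 + 1 + 1) p with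
      ⟨j, hj⟩ | ⟨a, ha, hp⟩
    · rw [res_comp_inner e _ _ j p hj, hx, hw0, h1]
    · rw [he.res_comp_outer _ _ a ha p hp, hx1, one_smul]
      obtain rfl : a = 1 := by omega
      exact hw1

/-- Seen through its restrictions, `x ∘ᵢ a` is the vector with `a` in coordinate `i` and zeros
elsewhere, so any tuple in the ideal is realised by a sum. -/
theorem IsZeroUnit.res_unit_comp {n : ℕ} {x : O.obj n} (hx : ∀ j, res e j x = O.one)
    (i j : Fin n) {a : O.obj 1} (ha : he.aug a = 0) :
    res e j (O.comp i rfl x a) = if j = i then a else 0 := by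
  split_ifs with h
  · subst h
    rw [res_comp_inner e _ _ 0 j (by simp), hx, res_one]
    exact O.one_comp a
  · rw [he.res_comp_outer _ _ j h j (by simp), ha, zero_smul]

/-- Every derivation of the augmentation ideal extends to a derivation of weight zero. -/
theorem IsTwoUnit.exists_der (hw : O.IsTwoUnit e w) (hGK : O.GKdim = 2)
    (d : AlgDer k he.augIdeal) : ∃ D : O.Der, he.weight D = 0 ∧ he.restrictHom D = d := by
  obtain ⟨d', hd0, hdm, hd⟩ := AlgDer.exists_extension he.augmentation he.augIdeal
    (fun _ => Iff.rfl) d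
  obtain ⟨f, hf⟩ : ∃ f : O.obj 1 →ₗ[k] O.obj 1, ∀ x, f x = d' x := ⟨d', fun _ => rfl⟩
  have hf0 : ∀ x, he.aug (f x) = 0 := fun x => (congrArg _ (hf x)).trans (hd0 x)
  have hfm : ∀ x y : O.obj 1, f (O.comp (m := 1) (n := 1) (r := 1) 0 rfl x y)
      = O.comp (m := 1) (n := 1) (r := 1) 0 rfl (f x) y
        + O.comp (m := 1) (n := 1) (r := 1) 0 rfl x (f y) := fun x y => by
    rw [hf, hf, hf]
    exact hdm x y
  choose u hu using fun n => hw.exists_units he n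
  -- The operation whose restrictions are `f (res e i θ)`; it exists because `f` takes values of
  -- augmentation zero. In arity 0 the sum is empty, whence weight zero.
  let F : ∀ n, Module.End k (O.obj n) := fun n =>
    ∑ i : Fin n, (O.comp i rfl (u n)) ∘ₗ f ∘ₗ res e i
  have hF : ∀ n θ, F n θ = ∑ i : Fin n, O.comp i rfl (u n) (f (res e i θ)) := fun n θ => by
    simp [F]
  have hres : ∀ n (j : Fin n) θ, res e j (F n θ) = f (res e j θ) := fun n j θ => by
    rw [hF, map_sum, Finset.sum_eq_single j]
    · rw [he.res_unit_comp (hu n) _ _ (hf0 _), if_pos rfl]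
    · intro i _ hij
      rw [he.res_unit_comp (hu n) _ _ (hf0 _), if_neg hij.symm]
    · simp
  have haug : ∀ n θ, he.aug (F n θ) = 0 := fun n θ => by
    rw [hF, map_sum]
    exact Finset.sum_eq_zero fun i _ => by rw [he.aug_comp, hf0, mul_zero]
  have hF1 : ∀ x, F 1 x = f x := fun x => hres 1 0 x
  let D : O.Der := ⟨F, by
    refine ⟨fun n σ θ => ?_, fun m n r i h μ ν => ?_⟩
    · rcases Nat.eq_zero_or_pos n with rfl | hn
      · rw [he.eq_zero_of_aug_eq_zero (haug 0 θ), map_zero,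
          he.eq_zero_of_aug_eq_zero (haug 0 (O.act σ θ))]
      · refine hw.ext_res hGK hn.ne' fun j => ?_
        rw [hres, res_act, res_act, hres]
    -- Arity 0 has no restrictions, so there the augmentation is compared instead.
    · rcases Nat.eq_zero_or_pos r with rfl | hr
      · rw [← sub_eq_zero]
        apply he.eq_zero_of_aug_eq_zero
        simp only [map_sub, map_add, he.aug_comp, haug, zero_mul, mul_zero, add_zero, sub_zero]
      · refine hw.ext_res hGK hr.ne' fun p => ?_
        rw [hres, map_add]
        rcases exists_insertPos i h p with ⟨j, hj⟩ | ⟨a, ha, hp⟩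
        · simp only [res_comp_inner e i h j p hj, hres, hfm]
        -- At an outer input the term with `F ν` drops out, since `F ν` has augmentation zero.
        · simp only [he.res_comp_outer i h a ha p hp, hres, haug, zero_smul, add_zero, map_smul]⟩
  refine ⟨D, ?_, ?_⟩
  · change -he.aug (F 0 e) = 0
    rw [haug, neg_zero]
  · refine Subtype.ext (LinearMap.ext fun a => Subtype.ext ?_)
    rw [he.restrictHom_apply, ← hd a]
    exact (hF1 _).trans (hf _)

theorem IsTwoUnit.mem_innerDer_iff (hw : O.IsTwoUnit e w) (hGK : O.GKdim = 2) (D : O.Der) :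
    D ∈ O.InnerDer ↔ he.restrictHom D ∈ AlgInnerDer k he.augIdeal := by
  constructor
  · rintro ⟨lam, h⟩
    -- Subtracting a multiple of the central identity keeps the commutator and lands in the ideal.
    refine ⟨⟨lam - he.aug lam • O.one, he.sub_aug_mem lam⟩, fun x => Subtype.ext ?_⟩
    have hx : D.1 1 x.1 = (show O.Unary from lam) * x.1 - x.1 * (show O.Unary from lam) := by
      refine (h 1 x.1).trans ?_
      rw [Fin.sum_univ_one]
      rfl
    rw [he.restrictHom_apply, hx]
    change _ = ((show O.Unary from lam) - he.aug lam • (1 : O.Unary)) * x.1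
      - x.1 * ((show O.Unary from lam) - he.aug lam • (1 : O.Unary))
    rw [sub_mul, mul_sub, smul_mul_assoc, mul_smul_comm, one_mul, mul_one, sub_sub_sub_cancel_right]
  · rintro ⟨a, ha⟩
    obtain ⟨b, hb⟩ : ∃ b : O.obj 1, b = a.1 := ⟨a.1, rfl⟩
    have hb0 : he.aug b = 0 := hb ▸ a.2
    have h1 : ∀ x : O.obj 1, O.comp (m := 1) (n := 1) (r := 1) 0 rfl O.one x = x := O.one_comp
    have h2 : ∀ x : O.obj 1, O.comp (m := 1) (n := 1) (r := 1) 0 rfl x O.one = x := O.comp_one 0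
    have hD : ∀ x : O.obj 1, D.1 1 x = O.comp (m := 1) (n := 1) (r := 1) 0 rfl b x
        - O.comp (m := 1) (n := 1) (r := 1) 0 rfl x b := fun x => by
      rw [he.map_unary_eq]
      have := congrArg Subtype.val (ha ⟨x - he.aug x • O.one, he.sub_aug_mem x⟩)
      refine this.trans ?_
      change O.comp (m := 1) (n := 1) (r := 1) 0 rfl a.1 (x - he.aug x • O.one)
        - O.comp (m := 1) (n := 1) (r := 1) 0 rfl (x - he.aug x • O.one) a.1 = _
      rw [← hb]
      simp only [map_sub, map_smul, LinearMap.sub_apply, LinearMap.smul_apply, h1, h2]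
      abel
    set c := he.weight D with hc
    -- The commutator with `b` fixes only arity 1. The shift by `-c • O.one` adds the scaling of
    -- weight `c`, so that the weights agree too.
    refine ⟨b - c • O.one, fun n θ => ?_⟩
    have haug : he.aug (b - c • O.one) = -c := by
      rw [map_sub, map_smul, hb0, he.aug_one, smul_eq_mul, mul_one, zero_sub]
    rcases Nat.eq_zero_or_pos n with rfl | hn
    · rw [he.map_nullary, ← sub_eq_zero]
      apply he.eq_zero_of_aug_eq_zero
      rw [Fin.sum_univ_zero, sub_zero, map_sub, map_smul, he.aug_comp, haug, smul_eq_mul, sub_self]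
    · refine hw.ext_res hGK hn.ne' fun j => ?_
      -- The term `i = j` is the product; each of the other `n - 1` contributes the augmentation
      -- `-c`.
      have hsum : ∑ i : Fin n, res e j (O.comp i rfl θ (b - c • O.one))
          = O.comp (m := 1) (n := 1) (r := 1) 0 rfl (res e j θ) (b - c • O.one)
            - (((n : k) - 1) * c) • res e j θ := by
        have h3 : ∀ i ∈ Finset.univ.erase j, res e j (O.comp i rfl θ (b - c • O.one))
            = -c • res e j θ := fun i hi => by
          rw [he.res_comp_outer i rfl j (Finset.ne_of_mem_erase hi).symm j (by simp), haug]
        rw [← Finset.add_sum_erase _ _ (Finset.mem_univ j), Finset.sum_congr rfl h3,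
          Finset.sum_const, Finset.card_erase_of_mem (Finset.mem_univ j), Finset.card_fin,
          res_comp_inner e j rfl 0 j (by simp), res_one, ← Nat.cast_smul_eq_nsmul k, smul_smul,
          Nat.cast_sub hn, Nat.cast_one, mul_neg, neg_smul, ← sub_eq_add_neg]
      rw [he.res_map, ← hc, hD, map_sub, map_sum, hsum,
        res_comp_inner e 0 _ j j (by simp), res_one]
      simp only [map_sub, map_smul, LinearMap.sub_apply, LinearMap.smul_apply, h1, h2]
      abel

end

end SymmOperad

theorem theorem0p4 {k : Type u} [Field k] (O : SymmOperad.{u, v} k) (e : O.obj 0)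
    (he : O.IsZeroUnit e) (h2 : ∃ w : O.obj 2, O.IsTwoUnit e w) (hGK : O.GKdim = 2) :
    ∃ (ι : k →ₗ⁅k⁆ O.Der) (π : O.Der →ₗ⁅k⁆ AlgDer k he.augIdeal),
      -- `ι` sends `c` to the derivation that multiplies `O(n)` by `(n - 1) c`
      (∀ (c : k) (n : ℕ) (θ : O.obj n), (ι c).1 n θ = (((n : k) - 1) * c) • θ) ∧
      -- `π` restricts a derivation to the augmentation ideal
      (∀ (D : O.Der) (a : he.augIdeal), (((π D).1 a : he.augIdeal) : O.Unary) = D.1 1 a.1) ∧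
      -- the short exact sequence
      Function.Injective ι ∧ ι.range = π.ker.toLieSubalgebra ∧ Function.Surjective π ∧
      -- the semidirect product decomposition, compatible with the sequence
      (∃ (ψ : AlgDer k he.augIdeal →ₗ⁅k⁆ LieDerivation k k k)
        (f : O.Der ≃ₗ⁅k⁆ (k ⋊⁅ψ⁆ AlgDer k he.augIdeal)),
        (∀ c : k, f (ι c) = LieAlgebra.SemiDirectSum.inl ψ c) ∧
        ∀ D : O.Der, LieAlgebra.SemiDirectSum.projr ψ (f D) = π D) ∧
      -- the isomorphism of first cohomology groups, induced by `π`
      ∃ g : O.H1 ≃ₗ⁅k⁆ HH1 k he.augIdeal, ∀ D : O.Der,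
        g (LieSubmodule.Quotient.mk D) = LieSubmodule.Quotient.mk (π D) := by
  obtain ⟨w, hw⟩ := h2
  -- The pair (weight, restriction) is a Lie morphism for the zero action, as the weight kills
  -- brackets.
  let F : O.Der →ₗ⁅k⁆ (k ⋊⁅(0 : AlgDer k he.augIdeal →ₗ⁅k⁆ LieDerivation k k k)⁆
      AlgDer k he.augIdeal) :=
    { toFun := fun D => ⟨he.weight D, he.restrictHom D⟩
      map_add' := fun D E => by simp
      map_smul' := fun c D => by simp
      map_lie' := fun {D E} => by
        simp [he.weight_lie, Ring.lie_def, mul_comm] }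
  have hF : Function.Bijective F := by
    constructor
    · intro D E h
      exact hw.der_ext he hGK (congrArg LieAlgebra.SemiDirectSum.left h)
        (congrArg LieAlgebra.SemiDirectSum.right h)
    · rintro ⟨c, d⟩
      obtain ⟨D, hD0, hD⟩ := hw.exists_der he hGK d
      refine ⟨SymmOperad.scalingHom O c + D, LieAlgebra.SemiDirectSum.ext ?_ ?_⟩
      · change he.weight (SymmOperad.scalingHom O c + D) = c
        rw [map_add, he.weight_scalingHom, hD0, add_zero]
      · change he.restrictHom (SymmOperad.scalingHom O c + D) = d
        rw [map_add, he.restrictHom_scalingHom, hD, zero_add]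
  have hsurj : Function.Surjective he.restrictHom := fun d => by
    obtain ⟨D, -, hD⟩ := hw.exists_der he hGK d
    exact ⟨D, hD⟩
  refine ⟨SymmOperad.scalingHom O, he.restrictHom, SymmOperad.scalingHom_apply,
    he.restrictHom_apply, Function.LeftInverse.injective he.weight_scalingHom, ?_, hsurj,
    ⟨0, LieEquiv.ofBijective F hF, fun c => ?_, fun D => rfl⟩,
    he.restrictHom.exists_quotient_equiv hsurj _ _ (hw.mem_innerDer_iff he hGK)⟩
  · ext D
    constructor
    · rintro ⟨c, rfl⟩
      exact he.restrictHom_scalingHom c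
    · intro hD
      refine ⟨he.weight D, hw.der_ext he hGK (he.weight_scalingHom _) ?_⟩
      exact (he.restrictHom_scalingHom _).trans (LieHom.mem_ker.1 hD).symm
  · exact LieAlgebra.SemiDirectSum.ext (he.weight_scalingHom c) (he.restrictHom_scalingHom c)
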